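/- All graphs are finite and simple. A graph is called Eulerian if every vertex has even degree (it need not be connected). A cycle decomposition of a graph $G$ is a set of pairwise edge-disjoint subgraphs of $G$, each of which is a cycle, that together cover $E(G)$; the cycle number $\mathrm{cn}(G)$ is the smallest size of a cycle decomposition of $G$. Theorem. Let $G$ be an Eulerian graph with at least one edge, with exactly $n$ non-isolated vertices and with maximum degree at most $4$. Then $G$ has a cycle decomposition, and $$\mathrm{cn}(G)\le\left\lfloor\frac{n-1}{2}\right\rfloor .$$ -/

import Mathlib

namespace CycleDecomp

variable {V : Type*} (G : SimpleGraph V)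

/-- A graph is Eulerian if all its vertices have even degree (connectedness is not required). -/
def IsEulerianGraph [G.LocallyFinite] : Prop :=
  ∀ v : V, Even (G.degree v)

variable {G}

/-- The subgraph `H` of `G` is a cycle: it consists of exactly the vertices and the edges of a
closed walk of `G` of positive length that repeats no edge, and no vertex except for its end. -/
def IsCycleSubgraph (H : G.Subgraph) : Prop :=
  ∃ (v : V) (p : G.Walk v v), p.IsCycle ∧ p.toSubgraph = H

/-- A cycle decomposition of `G`: a finite set of pairwise edge-disjoint subgraphs of `G`,
each of them a cycle, that together cover the edge set of `G`. -/
structure IsCycleDecomposition (D : Finset G.Subgraph) : Prop where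
  isCycle : ∀ H ∈ D, IsCycleSubgraph H
  edgeDisjoint : ∀ H ∈ D, ∀ H' ∈ D, H ≠ H' → Disjoint H.edgeSet H'.edgeSet
  cover : ⋃ H ∈ D, H.edgeSet = G.edgeSet

variable (G)

/-- The cycle number `cn(G)`: the least size of a cycle decomposition of `G`
(and `⊤` if `G` has no cycle decomposition). -/
noncomputable def cycleNumber : ℕ∞ :=
  ⨅ (D : Finset G.Subgraph) (_ : IsCycleDecomposition D), (D.card : ℕ∞)

end CycleDecomp

/-! The bound is proved in the form `2 * k + 1 ≤ n`, by induction on the number of edges over all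
nonempty graphs with degrees 0, 2 and 4; a counterexample with fewest edges is shown to have no edge
at all.

The engine is a saving argument. Suppressing a vertex of degree 2 with nonadjacent neighbours
(replacing the path `avb` by the edge `ab`) costs one vertex, and every decomposition lifts back
with the same number of cycles. So if some cycle can be removed after which two vertices become
isolated or can be suppressed, induction pays for that cycle (`hasSmallDecomposition_of_cycle`). The
main tool, `not_consecutive`, applies this to two consecutive vertices `u`, `v` of degree 4 on a
cycle: it is contradictory that the two remaining neighbours of `u`, and likewise those of `v`, are
nonadjacent or joined by an edge of the cycle, and that these two pairs differ. The closing paths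
come from `exists_walk_avoiding`: a minimal counterexample has no cut vertex, since the bounds for
two pieces sharing at most one vertex add up.

With this tool a minimal counterexample has no vertex of degree 2, and it contains a triangle, then
a diamond (two triangles sharing an edge `uv`), because without them the remaining neighbours cause
no obstruction. Conversely, diamonds are impossible. Equal fourth neighbours of `u` and `v`, a `K₄`,
and a wheel with four spokes (which is forced to be an octahedron) are excluded by explicit cycles.
The last configuration, a strip of triangles, needs a path joining its two ends outside `u` and `v`;
its absence would give an edge cut of size three, against parity. -/

namespace CycleDecomp

/-! ### Decompositions into cycles, and subdivision of an edge -/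

variable {V : Type*}

/-- The edges of `C` are exactly the edges of a cycle. -/
def IsCycleGraph (C : SimpleGraph V) : Prop :=
  ∃ (v : V) (p : (⊤ : SimpleGraph V).Walk v v), p.IsCycle ∧
    ∀ x y, C.Adj x y ↔ s(x, y) ∈ p.edges

/-- `G` is an edge-disjoint union of `k` cycles. -/
inductive DecomposesInto : SimpleGraph V → ℕ → Prop
  | bot : DecomposesInto ⊥ 0
  | sup {C G : SimpleGraph V} {k : ℕ} : IsCycleGraph C → Disjoint C G → DecomposesInto G k →
      DecomposesInto (C ⊔ G) (k + 1)

theorem DecomposesInto.union {G H : SimpleGraph V} {k l : ℕ} (hG : DecomposesInto G k)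
    (hH : DecomposesInto H l) (hd : Disjoint G H) : DecomposesInto (G ⊔ H) (k + l) := by
  induction hG with
  | bot => simpa using hH
  | @sup C G k hC hCG _ ih =>
    rw [disjoint_sup_left] at hd
    rw [sup_assoc, add_right_comm]
    exact .sup hC (disjoint_sup_right.2 ⟨hCG, hd.1⟩) (ih hd.2)

/-- Opens a cycle at a chosen edge. Once the cycle starts at `a`, the vertex `b` is its second or
its last but one vertex; in the latter case the cycle is reversed. -/
theorem exists_rotate_of_mem_edges {G : SimpleGraph V} {v a b : V} {p : G.Walk v v}
    (hp : p.IsCycle) (hab : s(a, b) ∈ p.edges) :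
    ∃ q : G.Walk b a, q.IsPath ∧ s(a, b) ∉ q.edges ∧
      ∀ e, e ∈ p.edges ↔ e = s(a, b) ∨ e ∈ q.edges := by
  classical
  obtain ⟨c, hc, hce⟩ : ∃ c : G.Walk a a, c.IsCycle ∧ ∀ e, e ∈ c.edges ↔ e ∈ p.edges :=
    ⟨p.rotate a (p.fst_mem_support_of_mem_edges hab), by simpa using hp,
      fun e => (p.rotate_edges _ _).mem_iff⟩
  have key : ∀ d : G.Walk a a, d.IsCycle → d.toSubgraph.Adj a b → d.snd = b →
      (∀ e, e ∈ d.edges ↔ e ∈ p.edges) → ∃ q : G.Walk b a, q.IsPath ∧ s(a, b) ∉ q.edges ∧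
      ∀ e, e ∈ p.edges ↔ e = s(a, b) ∨ e ∈ q.edges := by
    intro d hd _ hs hde
    cases d with
    | nil => exact absurd hd SimpleGraph.Walk.not_isCycle_nil
    | cons h q =>
      simp only [SimpleGraph.Walk.snd_cons] at hs
      subst hs
      rw [SimpleGraph.Walk.cons_isCycle_iff] at hd
      exact ⟨q, hd.1, hd.2, fun e => by rw [← hde]; simp⟩
  have hadj : c.toSubgraph.Adj a b := by
    rw [← SimpleGraph.Subgraph.mem_edgeSet, SimpleGraph.Walk.mem_edges_toSubgraph, hce]
    exact hab
  have hn := hc.neighborSet_toSubgraph_endpoint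
  have hb : b ∈ c.toSubgraph.neighborSet a := hadj
  rw [hn] at hb
  rcases hb with hb | hb
  · exact key c hc hadj hb.symm hce
  · refine key c.reverse hc.reverse ?_ ?_ ?_
    · simpa using hadj
    · rw [SimpleGraph.Walk.snd_reverse]; exact hb.symm
    · simpa using hce

/-- Replace the edge `ab` by the path `avb`. -/
def subdivide (G : SimpleGraph V) (a b v : V) : SimpleGraph V where
  Adj x y := (G.Adj x y ∧ s(x, y) ≠ s(a, b)) ∨ (x ≠ y ∧ (s(x, y) = s(a, v) ∨ s(x, y) = s(v, b)))
  symm := ⟨fun x y h => by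
    rw [Sym2.eq_swap (a := y)]
    exact h.imp (fun h => ⟨h.1.symm, h.2⟩) (fun h => ⟨h.1.symm, h.2⟩)⟩
  loopless := ⟨fun x h => h.elim (fun h => h.1.ne rfl) (fun h => h.1 rfl)⟩

theorem IsCycleGraph.subdivide {C : SimpleGraph V} (hC : IsCycleGraph C) {a b v : V}
    (hab : C.Adj a b) (hv : ∀ x, ¬ C.Adj v x) : IsCycleGraph (subdivide C a b v) := by
  obtain ⟨w, p, hp, hCp⟩ := hC
  obtain ⟨q, hq, hqe, hpq⟩ := exists_rotate_of_mem_edges hp ((hCp a b).1 hab)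
  have hva : a ≠ v := fun h => hv b (h ▸ hab)
  have hvb : v ≠ b := fun h => hv a (h ▸ hab.symm)
  have hvq : v ∉ q.support := by
    intro h
    have hnil : ¬ q.Nil := fun h => hab.ne h.eq.symm
    obtain ⟨e, he, hve⟩ := (SimpleGraph.Walk.mem_support_iff_exists_mem_edges_of_not_nil hnil).1 h
    obtain ⟨x, rfl⟩ := hve
    exact hv x ((hCp v x).2 ((hpq _).2 (Or.inr he)))
  have e1 : s(v, b) ∉ q.edges := fun h => hvq (q.fst_mem_support_of_mem_edges h)
  have e2 : s(a, v) ∉ q.edges := fun h => hvq (q.snd_mem_support_of_mem_edges h)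
  refine ⟨a, .cons (v := v) (by simpa using hva) (.cons (v := b) (by simpa using hvb) q), ?_, ?_⟩
  · rw [SimpleGraph.Walk.cons_isCycle_iff, SimpleGraph.Walk.cons_isPath_iff]
    refine ⟨⟨hq, hvq⟩, ?_⟩
    simp only [SimpleGraph.Walk.edges_cons, List.mem_cons, not_or]
    refine ⟨?_, e2⟩
    simp only [Sym2.eq_iff]
    rintro (⟨h, -⟩ | ⟨h, -⟩)
    · exact hva h
    · exact hab.ne h
  · intro x y
    simp only [CycleDecomp.subdivide, SimpleGraph.Walk.edges_cons, List.mem_cons, hCp, hpq]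
    constructor
    · rintro (⟨h, h'⟩ | ⟨-, h⟩)
      · tauto
      · tauto
    · rintro (h | h | h)
      · refine Or.inr ⟨?_, Or.inl h⟩
        rintro rfl
        rw [Sym2.eq_iff] at h; aesop
      · refine Or.inr ⟨?_, Or.inr h⟩
        rintro rfl
        rw [Sym2.eq_iff] at h; aesop
      · exact Or.inl ⟨Or.inr h, fun h' => hqe (h' ▸ h)⟩

/-- Exactly one cycle contains `ab`; it is subdivided, and the others stay. As `v` is isolated, the
new edges belong to no other cycle. -/
theorem DecomposesInto.subdivide {G : SimpleGraph V} {k : ℕ} (hG : DecomposesInto G k) {a b v : V}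
    (hab : G.Adj a b) (hv : ∀ x, ¬ G.Adj v x) : DecomposesInto (subdivide G a b v) k := by
  induction hG with
  | bot => simp at hab
  | @sup C G k hC hCG hG ih =>
    have hvC : ∀ x, ¬ C.Adj v x := fun x h => hv x (Or.inl h)
    have hvG : ∀ x, ¬ G.Adj v x := fun x h => hv x (Or.inr h)
    have hd : ∀ {x y}, C.Adj x y → ¬ G.Adj x y := fun {x y} h h' =>
      SimpleGraph.disjoint_left.1 hCG x y h h'
    have hs : ∀ {H : SimpleGraph V}, (∀ x, ¬ H.Adj v x) → ∀ {x y}, H.Adj x y →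
        s(x, y) ≠ s(a, v) ∧ s(x, y) ≠ s(v, b) := by
      intro H hH x y h
      simp only [ne_eq, Sym2.eq_iff, not_or, not_and]
      refine ⟨⟨fun _ h2 => hH x (h2 ▸ h.symm), fun h1 => absurd (h1 ▸ h) (hH _)⟩,
        fun h1 => absurd (h1 ▸ h) (hH _), fun _ h2 => hH x (h2 ▸ h.symm)⟩
    by_cases hCab : C.Adj a b
    · have : CycleDecomp.subdivide (C ⊔ G) a b v = CycleDecomp.subdivide C a b v ⊔ G := by
        ext x y
        simp only [CycleDecomp.subdivide, SimpleGraph.sup_adj]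
        have : G.Adj x y → s(x, y) ≠ s(a, b) := by
          intro h h'
          rw [Sym2.eq_iff] at h'
          rcases h' with ⟨rfl, rfl⟩ | ⟨rfl, rfl⟩
          · exact hd hCab h
          · exact hd hCab h.symm
        tauto
      rw [this]
      refine .sup (hC.subdivide hCab hvC) ?_ hG
      rw [SimpleGraph.disjoint_left]
      intro x y h h'
      rcases h with h | h
      · exact hd h.1 h'
      · have := hs hvG h'
        tauto
    · have hGab : G.Adj a b := hab.resolve_left hCab
      have : CycleDecomp.subdivide (C ⊔ G) a b v = C ⊔ CycleDecomp.subdivide G a b v := by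
        ext x y
        simp only [CycleDecomp.subdivide, SimpleGraph.sup_adj]
        have : C.Adj x y → s(x, y) ≠ s(a, b) := by
          intro h h'
          rw [Sym2.eq_iff] at h'
          rcases h' with ⟨rfl, rfl⟩ | ⟨rfl, rfl⟩
          · exact hCab h
          · exact hCab h.symm
        tauto
      rw [this]
      refine .sup hC ?_ (ih hGab hvG)
      rw [SimpleGraph.disjoint_left]
      intro x y h h'
      rcases h' with h' | h'
      · exact hd h h'.1
      · have := hs hvC h
        tauto

/-- The ambient graph `G` is kept apart from `H` so that all cycles are subgraphs of one fixed graph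
during the induction. -/
theorem DecomposesInto.exists_isCycleDecomposition {G H : SimpleGraph V} {k : ℕ}
    (hH : DecomposesInto H k) (hHG : H ≤ G) :
    ∃ D : Finset G.Subgraph, (∀ K ∈ D, IsCycleSubgraph K) ∧
      (∀ K ∈ D, ∀ K' ∈ D, K ≠ K' → Disjoint K.edgeSet K'.edgeSet) ∧
      ⋃ K ∈ D, K.edgeSet = H.edgeSet ∧ D.card ≤ k := by
  classical
  induction hH with
  | bot => exact ⟨∅, by simp⟩
  | @sup C H k hC hCH _ ih =>
    obtain ⟨D, h1, h2, h3, h4⟩ := ih (le_sup_right.trans hHG)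
    obtain ⟨v, p, hp, hCp⟩ := hC
    have hpG : ∀ e ∈ p.edges, e ∈ G.edgeSet := by
      intro e
      induction e with
      | _ x y => exact fun h => hHG (Or.inl ((hCp x y).2 h))
    set q := p.transfer G hpG
    have hq : q.IsCycle := hp.transfer hpG
    have hqC : q.toSubgraph.edgeSet = C.edgeSet := by
      ext e
      induction e with
      | _ x y =>
        rw [SimpleGraph.Walk.mem_edges_toSubgraph, SimpleGraph.Walk.edges_transfer]
        exact (hCp x y).symm
    have hdis : Disjoint C.edgeSet H.edgeSet := SimpleGraph.disjoint_edgeSet.2 hCH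
    have hD : ∀ K ∈ D, Disjoint q.toSubgraph.edgeSet K.edgeSet := by
      intro K hK
      rw [hqC]
      refine hdis.mono_right ?_
      rw [← h3]
      exact Set.subset_biUnion_of_mem (u := fun K : G.Subgraph => K.edgeSet) hK
    refine ⟨insert q.toSubgraph D, ?_, ?_, ?_, ?_⟩
    · intro K hK
      rcases Finset.mem_insert.1 hK with rfl | hK
      · exact ⟨v, q, hq, rfl⟩
      · exact h1 K hK
    · intro K hK K' hK' hne
      rcases Finset.mem_insert.1 hK with rfl | hK <;> rcases Finset.mem_insert.1 hK' with rfl | hK'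
      · exact absurd rfl hne
      · exact hD _ hK'
      · exact (hD _ hK).symm
      · exact h2 K hK K' hK' hne
    · rw [Finset.set_biUnion_insert, h3, hqC, SimpleGraph.edgeSet_sup]
    · exact (Finset.card_insert_le _ _).trans (by omega)

theorem DecomposesInto.cycleNumber_le {G : SimpleGraph V} {k : ℕ} (hG : DecomposesInto G k) :
    cycleNumber G ≤ k := by
  obtain ⟨D, h1, h2, h3, h4⟩ := hG.exists_isCycleDecomposition le_rfl
  exact (iInf₂_le D ⟨h1, h2, h3⟩).trans (by exact_mod_cast h4)

/-! ### Suppression of vertices, and induction after removing a cycle -/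

/-- Every vertex has degree `0`, `2` or `4`. -/
def IsEvenLeFour (G : SimpleGraph V) : Prop :=
  ∀ v, Even (G.neighborSet v).ncard ∧ (G.neighborSet v).ncard ≤ 4

/-- The bound `2 k + 1 ≤ n` for some decomposition of `G` into `k` cycles. -/
def HasSmallDecomposition (G : SimpleGraph V) : Prop :=
  ∃ k, DecomposesInto G k ∧ 2 * k + 1 ≤ G.support.ncard

/-- The bound holds for all nonempty graphs with fewer edges. -/
def HoldsBelow (G : SimpleGraph V) : Prop :=
  ∀ H : SimpleGraph V, IsEvenLeFour H → H ≠ ⊥ → H.edgeSet.ncard < G.edgeSet.ncard →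
    HasSmallDecomposition H

theorem IsCycleGraph.ncard_neighborSet {C : SimpleGraph V} (hC : IsCycleGraph C) (v : V) :
    (C.neighborSet v).ncard = 0 ∨ (C.neighborSet v).ncard = 2 := by
  obtain ⟨w, p, hp, hCp⟩ := hC
  have h : C.neighborSet v = p.toSubgraph.neighborSet v := by
    ext x
    rw [SimpleGraph.mem_neighborSet, hCp, SimpleGraph.Subgraph.mem_neighborSet,
      ← SimpleGraph.Subgraph.mem_edgeSet, SimpleGraph.Walk.mem_edges_toSubgraph]
  by_cases hv : v ∈ p.support
  · exact Or.inr (h ▸ hp.ncard_neighborSet_toSubgraph_eq_two hv)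
  · refine Or.inl ?_
    have : C.neighborSet v = ∅ := by
      ext x
      simp only [SimpleGraph.mem_neighborSet, hCp, Set.mem_empty_iff_false, iff_false]
      exact fun h => hv (p.fst_mem_support_of_mem_edges h)
    rw [this, Set.ncard_empty]

theorem IsCycleGraph.ne_bot {C : SimpleGraph V} (hC : IsCycleGraph C) : C ≠ ⊥ := by
  obtain ⟨w, p, hp, hCp⟩ := hC
  rintro rfl
  cases p with
  | nil => exact SimpleGraph.Walk.not_isCycle_nil hp
  | cons h q => exact (hCp w _).2 (by rw [SimpleGraph.Walk.edges_cons]; exact List.mem_cons_self)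

theorem exists_adj_of_ne_bot {G : SimpleGraph V} (h : G ≠ ⊥) : ∃ x y, G.Adj x y := by
  by_contra! hc
  exact h (by ext x y; simp [hc])

/-- Replace the paths `avb` through `v` by the edge `ab`. -/
def suppress (G : SimpleGraph V) (v a b : V) : SimpleGraph V where
  Adj x y := (G.Adj x y ∧ x ≠ v ∧ y ≠ v) ∨ (x ≠ y ∧ s(x, y) = s(a, b))
  symm := ⟨fun x y h => by
    rw [Sym2.eq_swap (a := y)]
    exact h.imp (fun h => ⟨h.1.symm, h.2.2, h.2.1⟩) (fun h => ⟨h.1.symm, h.2⟩)⟩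
  loopless := ⟨fun x h => h.elim (fun h => h.1.ne rfl) (fun h => h.1 rfl)⟩

section Suppress

variable {G : SimpleGraph V} {v a b : V}

/-- Nonadjacency of `a` and `b` is essential: an existing edge `ab` would merge with the new one and
be lost on subdividing. -/
theorem subdivide_suppress (hv : ∀ x, G.Adj v x ↔ x = a ∨ x = b) (hab : ¬ G.Adj a b) :
    subdivide (suppress G v a b) a b v = G := by
  have hva : v ≠ a := ((hv a).2 (Or.inl rfl)).ne
  have hvb : v ≠ b := ((hv b).2 (Or.inr rfl)).ne
  ext x y
  have h1 := hv x
  have h2 := hv y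
  have h3 := G.adj_comm x y
  have h4 := G.adj_comm a b
  have h5 : x ≠ y ∨ x = y := ne_or_eq x y
  have h6 := G.loopless.irrefl x
  simp only [subdivide, suppress, Sym2.eq_iff, ne_eq]
  grind

theorem DecomposesInto.of_suppress {k : ℕ} (h : DecomposesInto (suppress G v a b) k)
    (hv : ∀ x, G.Adj v x ↔ x = a ∨ x = b) (hne : a ≠ b) (hab : ¬ G.Adj a b) :
    DecomposesInto G k := by
  have hva : v ≠ a := ((hv a).2 (Or.inl rfl)).ne
  have hvb : v ≠ b := ((hv b).2 (Or.inr rfl)).ne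
  rw [← subdivide_suppress hv hab]
  refine h.subdivide (Or.inr ⟨hne, rfl⟩) ?_
  rintro x (h | h)
  · exact h.2.1 rfl
  · rw [Sym2.eq_iff] at h; tauto

theorem support_suppress_subset (hv : ∀ x, G.Adj v x ↔ x = a ∨ x = b) :
    (suppress G v a b).support ⊆ G.support \ {v} := by
  have hva : G.Adj v a := (hv a).2 (Or.inl rfl)
  have hvb : G.Adj v b := (hv b).2 (Or.inr rfl)
  rintro x ⟨y, h | h⟩
  · exact ⟨⟨y, h.1⟩, h.2.1⟩
  · rw [Sym2.eq_iff] at h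
    rcases h.2 with ⟨rfl, -⟩ | ⟨rfl, -⟩
    · exact ⟨⟨v, hva.symm⟩, hva.ne'⟩
    · exact ⟨⟨v, hvb.symm⟩, hvb.ne'⟩

end Suppress

section Finite

variable [Finite V]

theorem IsCycleGraph.three_le {C : SimpleGraph V} (hC : IsCycleGraph C) :
    3 ≤ C.support.ncard := by
  obtain ⟨x, y, hxy⟩ := exists_adj_of_ne_bot hC.ne_bot
  have h2 : (C.neighborSet x).ncard = 2 := by
    refine (hC.ncard_neighborSet x).resolve_left fun h => ?_
    rw [Set.ncard_eq_zero] at h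
    exact (h ▸ (show y ∈ C.neighborSet x from hxy) : y ∈ (∅ : Set V))
  have : (insert x (C.neighborSet x)).ncard = 3 := by
    rw [Set.ncard_insert_of_notMem (by simp), h2]
  rw [← this]
  refine Set.ncard_le_ncard ?_
  rintro z (rfl | hz)
  · exact ⟨y, hxy⟩
  · exact ⟨x, hz.symm⟩

theorem IsEvenLeFour.of_le {G H : SimpleGraph V} (hG : IsEvenLeFour G) (hHG : H ≤ G)
    (hH : ∀ v, Even (H.neighborSet v).ncard) : IsEvenLeFour H := fun v =>
  ⟨hH v, (Set.ncard_le_ncard fun _ h => hHG h).trans (hG v).2⟩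

theorem ncard_neighborSet_sdiff {G H : SimpleGraph V} (h : H ≤ G) (v : V) :
    ((G \ H).neighborSet v).ncard + (H.neighborSet v).ncard = (G.neighborSet v).ncard := by
  have : (G \ H).neighborSet v = G.neighborSet v \ H.neighborSet v := by
    ext x; simp
  rw [this]
  exact Set.ncard_sdiff_add_ncard_of_subset fun _ hx => h hx

theorem IsEvenLeFour.sdiff {G H : SimpleGraph V} (hG : IsEvenLeFour G) (hHG : H ≤ G)
    (hH : ∀ v, Even (H.neighborSet v).ncard) : IsEvenLeFour (G \ H) :=
  hG.of_le sdiff_le fun v => by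
    have := ncard_neighborSet_sdiff hHG v
    have h1 := (hG v).1
    rw [← this, Nat.even_add] at h1
    exact h1.2 (hH v)

theorem IsEvenLeFour.sdiff_isCycleGraph {G C : SimpleGraph V} (hG : IsEvenLeFour G) (hCG : C ≤ G)
    (hC : IsCycleGraph C) : IsEvenLeFour (G \ C) :=
  hG.sdiff hCG fun v => by rcases hC.ncard_neighborSet v with h | h <;> rw [h] <;> decide

theorem ncard_edgeSet_sdiff_lt {G C : SimpleGraph V} (hCG : C ≤ G) (hC : C ≠ ⊥) :
    (G \ C).edgeSet.ncard < G.edgeSet.ncard := by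
  obtain ⟨x, y, hxy⟩ := exists_adj_of_ne_bot hC
  refine Set.ncard_lt_ncard ?_
  rw [SimpleGraph.edgeSet_ssubset_edgeSet]
  refine lt_of_le_of_ne sdiff_le fun h => ?_
  have : (G \ C).Adj x y := by rw [h]; exact hCG hxy
  exact this.2 hxy

/-- The saving argument. `H` is what `G \ C` becomes after suppressions; the two vertices lost pay
for the one cycle `C`. -/
theorem hasSmallDecomposition_of_cycle {G C H : SimpleGraph V} (hB : HoldsBelow G)
    (hCG : C ≤ G) (hC : IsCycleGraph C) (hH : IsEvenLeFour H)
    (hdec : ∀ k, DecomposesInto H k → DecomposesInto (G \ C) k)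
    (hedge : H.edgeSet.ncard ≤ (G \ C).edgeSet.ncard)
    (hsupp : H.support.ncard + 2 ≤ G.support.ncard) : HasSmallDecomposition G := by
  have hG : ∀ {k}, DecomposesInto H k → DecomposesInto G (k + 1) := fun {k} h => by
    have := DecomposesInto.sup hC disjoint_sdiff_self_right (hdec k h)
    rwa [sup_sdiff_cancel_right hCG] at this
  -- The bound fails for the empty graph, where it would read `1 ≤ 0`. In that case `C` alone
  -- decomposes `G`, and a cycle has at least three vertices.
  by_cases hbot : H = ⊥
  · subst hbot
    refine ⟨1, hG .bot, hC.three_le.trans (Set.ncard_le_ncard ?_)⟩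
    exact SimpleGraph.support_mono hCG
  · obtain ⟨k, hk, hk'⟩ := hB H hH hbot (hedge.trans_lt (ncard_edgeSet_sdiff_lt hCG hC.ne_bot))
    exact ⟨k + 1, hG hk, by omega⟩

section Suppress

variable {G : SimpleGraph V} {v a b : V}

theorem IsEvenLeFour.suppress (hG : IsEvenLeFour G)
    (hv : ∀ x, G.Adj v x ↔ x = a ∨ x = b) (hne : a ≠ b) (hab : ¬ G.Adj a b) :
    IsEvenLeFour (suppress G v a b) := by
  have hva : G.Adj v a := (hv a).2 (Or.inl rfl)
  have hvb : G.Adj v b := (hv b).2 (Or.inr rfl)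
  have key : ∀ x c d : V, d ∉ G.neighborSet x → c ∈ G.neighborSet x →
      (insert d (G.neighborSet x \ {c})).ncard = (G.neighborSet x).ncard := by
    intro x c d hd hc
    rw [Set.ncard_insert_of_notMem (fun h => hd h.1), Set.ncard_sdiff_singleton_add_one hc]
  intro x
  by_cases hxv : x = v
  · have : (CycleDecomp.suppress G v a b).neighborSet x = ∅ := by
      subst hxv
      ext y
      have := hva.ne
      have := hvb.ne
      simp [CycleDecomp.suppress]
      tauto
    rw [this]; simp
  suffices ((CycleDecomp.suppress G v a b).neighborSet x).ncard = (G.neighborSet x).ncard by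
    rw [this]; exact hG x
  by_cases hxa : x = a
  · subst hxa
    rw [← key x v b hab hva.symm]
    congr 1
    ext y
    simp only [CycleDecomp.suppress, SimpleGraph.mem_neighborSet, Sym2.eq_iff, Set.mem_insert_iff,
      Set.mem_sdiff, Set.mem_singleton_iff]
    have : y = b → x ≠ y := by rintro rfl; exact hne
    tauto
  by_cases hxb : x = b
  · subst hxb
    rw [← key x v a (fun h => hab h.symm) hvb.symm]
    congr 1
    ext y
    simp only [CycleDecomp.suppress, SimpleGraph.mem_neighborSet, Sym2.eq_iff, Set.mem_insert_iff,
      Set.mem_sdiff, Set.mem_singleton_iff]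
    have : y = a → x ≠ y := by rintro rfl; exact hne.symm
    tauto
  · congr 1
    ext y
    simp only [CycleDecomp.suppress, SimpleGraph.mem_neighborSet, Sym2.eq_iff]
    have : G.Adj x y → y ≠ v := by
      rintro h rfl
      have := (hv x).1 h.symm
      tauto
    tauto

/-- Two edges disappear and at most one is created. -/
theorem ncard_edgeSet_suppress_lt (hv : ∀ x, G.Adj v x ↔ x = a ∨ x = b) (hne : a ≠ b) :
    (suppress G v a b).edgeSet.ncard < G.edgeSet.ncard := by
  have hva : G.Adj v a := (hv a).2 (Or.inl rfl)
  have hvb : G.Adj v b := (hv b).2 (Or.inr rfl)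
  have hsub : (suppress G v a b).edgeSet ⊆
      insert s(a, b) ((G.edgeSet \ {s(v, a)}) \ {s(v, b)}) := by
    intro e
    induction e with
    | _ x y =>
      rintro (h | h)
      · refine Or.inr ⟨⟨h.1, ?_⟩, ?_⟩ <;>
        · simp only [Set.mem_singleton_iff, Sym2.eq_iff]; tauto
      · exact Or.inl h.2
  have h1 := Set.ncard_le_ncard hsub
  have h2 := Set.ncard_insert_le s(a, b) ((G.edgeSet \ {s(v, a)}) \ {s(v, b)})
  have h3 : ((G.edgeSet \ {s(v, a)}) \ {s(v, b)}).ncard + 1 = (G.edgeSet \ {s(v, a)}).ncard :=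
    Set.ncard_sdiff_singleton_add_one ⟨hvb, by
      simp only [Set.mem_singleton_iff, Sym2.eq_iff]
      have := hvb.ne'
      tauto⟩
  have h4 : (G.edgeSet \ {s(v, a)}).ncard + 1 = G.edgeSet.ncard :=
    Set.ncard_sdiff_singleton_add_one hva
  omega

end Suppress

variable {G C : SimpleGraph V}

theorem hasSmallDecomposition_of_suppress {v a b : V} (hB : HoldsBelow G) (hG : IsEvenLeFour G)
    (hv : ∀ x, G.Adj v x ↔ x = a ∨ x = b) (hne : a ≠ b) (hab : ¬ G.Adj a b) :
    HasSmallDecomposition G := by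
  have hbot : suppress G v a b ≠ ⊥ := by
    intro h
    have : (suppress G v a b).Adj a b := Or.inr ⟨hne, rfl⟩
    rw [h] at this
    exact this
  obtain ⟨k, hk, hk'⟩ := hB _ (hG.suppress hv hne hab) hbot (ncard_edgeSet_suppress_lt hv hne)
  exact ⟨k, hk.of_suppress hv hne hab, hk'.trans (Set.ncard_le_ncard
    ((support_suppress_subset hv).trans Set.sdiff_subset))⟩

theorem ncard_add_two_le {S T : Set V} {u v : V} (hST : S ⊆ (T \ {u}) \ {v}) (hu : u ∈ T)
    (hv : v ∈ T) (huv : u ≠ v) : S.ncard + 2 ≤ T.ncard := by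
  have h1 := Set.ncard_le_ncard hST
  have h2 : ((T \ {u}) \ {v}).ncard + 1 = (T \ {u}).ncard :=
    Set.ncard_sdiff_singleton_add_one ⟨hv, huv.symm⟩
  have h3 : (T \ {u}).ncard + 1 = T.ncard := Set.ncard_sdiff_singleton_add_one hu
  omega

theorem hasSmallDecomposition_of_isolate_suppress {u v s t : V} (hB : HoldsBelow G)
    (hG : IsEvenLeFour G) (hCG : C ≤ G) (hC : IsCycleGraph C) (hvG : v ∈ G.support)
    (hv : ∀ x, ¬ (G \ C).Adj v x) (hu : ∀ x, (G \ C).Adj u x ↔ x = s ∨ x = t)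
    (hst : s ≠ t) (hnst : ¬ (G \ C).Adj s t) : HasSmallDecomposition G := by
  have hus := (hu s).2 (Or.inl rfl)
  refine hasSmallDecomposition_of_cycle hB hCG hC
    ((hG.sdiff_isCycleGraph hCG hC).suppress hu hst hnst)
    (fun k h => h.of_suppress hu hst hnst) (ncard_edgeSet_suppress_lt hu hst).le
    (ncard_add_two_le (u := u) (v := v) ?_ ⟨s, hus.1⟩ hvG ?_)
  · intro x hx
    obtain ⟨hx1, hx2⟩ := support_suppress_subset hu hx
    refine ⟨⟨SimpleGraph.support_mono sdiff_le hx1, hx2⟩, ?_⟩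
    rintro rfl
    obtain ⟨y, hy⟩ := hx1
    exact hv y hy
  · rintro rfl
    exact hv s hus

/-- Suppressing `u` must not spoil `v`: since `u` and `v` are nonadjacent in `G \ C`, the neighbours
of `v` do not change, and since the pairs differ, the new edge `st` does not join `y` to `z`. -/
theorem hasSmallDecomposition_of_suppress_suppress {u v s t y z : V} (hB : HoldsBelow G)
    (hG : IsEvenLeFour G) (hCG : C ≤ G) (hC : IsCycleGraph C) (huv : u ≠ v)
    (hnuv : ¬ (G \ C).Adj u v)
    (hu : ∀ x, (G \ C).Adj u x ↔ x = s ∨ x = t) (hst : s ≠ t) (hnst : ¬ (G \ C).Adj s t)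
    (hv : ∀ x, (G \ C).Adj v x ↔ x = y ∨ x = z) (hyz : y ≠ z) (hnyz : ¬ (G \ C).Adj y z)
    (hne : s(s, t) ≠ s(y, z)) : HasSmallDecomposition G := by
  have hus := (hu s).2 (Or.inl rfl)
  have hvy := (hv y).2 (Or.inl rfl)
  have hE := (hG.sdiff_isCycleGraph hCG hC).suppress hu hst hnst
  have hvs : v ≠ s := by rintro rfl; exact hnuv hus
  have hvt : v ≠ t := by rintro rfl; exact hnuv ((hu v).2 (Or.inr rfl))
  have hv' : ∀ x, (suppress (G \ C) u s t).Adj v x ↔ x = y ∨ x = z := by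
    intro x
    have h1 : (suppress (G \ C) u s t).Adj v x ↔ (G \ C).Adj v x := by
      simp only [suppress, Sym2.eq_iff]
      have : (G \ C).Adj v x → x ≠ u := by
        rintro h rfl
        exact hnuv h.symm
      tauto
    rw [h1, hv]
  have hnyz' : ¬ (suppress (G \ C) u s t).Adj y z := by
    rintro (h | h)
    · exact hnyz h.1
    · exact hne h.2.symm
  refine hasSmallDecomposition_of_cycle hB hCG hC (hE.suppress hv' hyz hnyz')
    (fun k h => (h.of_suppress hv' hyz hnyz').of_suppress hu hst hnst)
    ((ncard_edgeSet_suppress_lt hv' hyz).trans (ncard_edgeSet_suppress_lt hu hst)).le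
    (ncard_add_two_le (u := u) (v := v) ?_ ⟨s, hus.1⟩ ⟨y, hvy.1⟩ huv)
  intro x hx
  obtain ⟨hx1, hx2⟩ := support_suppress_subset hv' hx
  obtain ⟨hx3, hx4⟩ := support_suppress_subset hu hx1
  exact ⟨⟨SimpleGraph.support_mono sdiff_le hx3, hx4⟩, hx2⟩

end Finite

/-! ### Minimal counterexamples: cut vertices and the two-vertex tool -/

/-- The graph formed by the edges of `G` with at least one end in `A`. -/
def touching (G : SimpleGraph V) (A : Set V) : SimpleGraph V where
  Adj x y := G.Adj x y ∧ (x ∈ A ∨ y ∈ A)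
  symm := ⟨fun _ _ h => ⟨h.1.symm, h.2.symm⟩⟩
  loopless := ⟨fun _ h => h.1.ne rfl⟩

/-- Handshake lemma: a single vertex of odd degree is impossible. -/
theorem even_ncard_neighborSet_of_forall_ne [Finite V] {G : SimpleGraph V} (v : V)
    (h : ∀ w, w ≠ v → Even (G.neighborSet w).ncard) : Even (G.neighborSet v).ncard := by
  classical
  have := Fintype.ofFinite V
  have hd : ∀ w, (G.neighborSet w).ncard = G.degree w := fun w => by
    rw [Set.ncard_eq_toFinset_card', SimpleGraph.degree, SimpleGraph.neighborFinset]
  by_contra hv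
  rw [Nat.not_even_iff_odd, hd] at hv
  obtain ⟨w, hw, hw'⟩ := G.exists_ne_odd_degree_of_exists_odd_degree v hv
  have := h w hw
  rw [hd] at this
  exact Nat.not_even_iff_odd.2 hw' this

theorem neighborSet_touching_of_mem {G : SimpleGraph V} {A : Set V} {v : V} (hv : v ∈ A) :
    (touching G A).neighborSet v = G.neighborSet v := by
  ext x; simp [touching, hv]

theorem neighborSet_touching_of_notMem {G : SimpleGraph V} {A : Set V} {v : V} (hv : v ∉ A) :
    (touching G A).neighborSet v = G.neighborSet v ∩ A := by
  ext x; simp [touching, hv]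

/-- A graph of even degrees at most four violating the bound, while all smaller ones satisfy it. -/
structure IsMinimalCounterexample (G : SimpleGraph V) : Prop where
  even : IsEvenLeFour G
  below : HoldsBelow G
  not_small : ¬ HasSmallDecomposition G

/-- Stop at the first entry into `S` and shortcut what precedes. No vertex outside `W` is used, so
whatever `W` avoids stays avoided. -/
theorem exists_path_of_walk_to {G : SimpleGraph V} {S : Set V} {x y : V} (W : G.Walk x y)
    (hx : x ∉ S) (hy : y ∈ S) :
    ∃ (s' s : V) (q : G.Walk x s'), q.IsPath ∧ G.Adj s' s ∧ s ∈ S ∧ s ∈ W.support ∧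
      ∀ t ∈ q.support, t ∉ S ∧ t ∈ W.support := by
  classical
  induction W with
  | nil => exact absurd hy hx
  | @cons x x' y h p ih =>
    by_cases hx' : x' ∈ S
    · exact ⟨x, x', .nil, .nil, h, hx', by simp, by simpa using hx⟩
    · obtain ⟨s', s, q, -, hadj, hs, hsp, hq⟩ := ih hx' hy
      refine ⟨s', s, (SimpleGraph.Walk.cons h q).bypass, SimpleGraph.Walk.bypass_isPath _, hadj, hs,
        by simp [hsp], fun t ht => ?_⟩
      have ht := SimpleGraph.Walk.support_bypass_subset_support _ ht
      rw [SimpleGraph.Walk.support_cons, List.mem_cons] at ht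
      rcases ht with rfl | ht
      · exact ⟨hx, by simp⟩
      · exact ⟨(hq t ht).1, by simp [(hq t ht).2]⟩

/-- The neighbours of `u` are the four distinct vertices `a`, `b`, `c`, `d`. -/
structure HasNeighbors (G : SimpleGraph V) (u a b c d : V) : Prop where
  adj_iff : ∀ x, G.Adj u x ↔ x = a ∨ x = b ∨ x = c ∨ x = d
  nodup : [a, b, c, d].Nodup

section Closed

variable {G : SimpleGraph V} {u v o r : V}

/-- The cycle formed by the path `o u v r` and a path from `r` to `o`. -/
def closedPath (P : G.Walk r o) (u v : V) : SimpleGraph V :=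
  SimpleGraph.fromEdgeSet {e | e = s(o, u) ∨ e = s(u, v) ∨ e = s(v, r) ∨ e ∈ P.edges}

variable {P : G.Walk r o}

theorem closedPath_adj (hou : G.Adj o u) (huv : G.Adj u v) (hvr : G.Adj v r) (x y : V) :
    (closedPath P u v).Adj x y ↔
      s(x, y) = s(o, u) ∨ s(x, y) = s(u, v) ∨ s(x, y) = s(v, r) ∨ s(x, y) ∈ P.edges := by
  rw [closedPath, SimpleGraph.fromEdgeSet_adj]
  refine and_iff_left_of_imp ?_
  have key : s(x, y) ∈ G.edgeSet → x ≠ y := fun h => SimpleGraph.Adj.ne h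
  rintro (h | h | h | h)
  · exact key (h ▸ hou)
  · exact key (h ▸ huv)
  · exact key (h ▸ hvr)
  · exact key (P.edges_subset_edgeSet h)

theorem closedPath_le (hou : G.Adj o u) (huv : G.Adj u v) (hvr : G.Adj v r) :
    closedPath P u v ≤ G := by
  intro x y h
  rw [closedPath_adj hou huv hvr] at h
  rw [← SimpleGraph.mem_edgeSet]
  rcases h with h | h | h | h
  · exact h ▸ hou
  · exact h ▸ huv
  · exact h ▸ hvr
  · exact P.edges_subset_edgeSet h

theorem isCycleGraph_closedPath (hou : G.Adj o u) (huv : G.Adj u v) (hvr : G.Adj v r)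
    (hP : P.IsPath) (hu : u ∉ P.support) (hv : v ∉ P.support) :
    IsCycleGraph (closedPath P u v) := by
  have hc : (SimpleGraph.Walk.cons hou (.cons huv (.cons hvr P))).IsCycle := by
    rw [SimpleGraph.Walk.cons_isCycle_iff, SimpleGraph.Walk.cons_isPath_iff,
      SimpleGraph.Walk.cons_isPath_iff]
    refine ⟨⟨⟨hP, hv⟩, ?_⟩, ?_⟩
    · rw [SimpleGraph.Walk.support_cons, List.mem_cons, not_or]
      exact ⟨huv.ne, hu⟩
    · simp only [SimpleGraph.Walk.edges_cons, List.mem_cons, not_or]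
      have hvo : v ≠ o := by rintro rfl; exact hv P.end_mem_support
      have hur : u ≠ r := by rintro rfl; exact hu P.start_mem_support
      refine ⟨?_, ?_, fun h => hu (P.snd_mem_support_of_mem_edges h)⟩
      · have := hou.ne
        rw [Sym2.eq_iff]; tauto
      · have := huv.ne
        rw [Sym2.eq_iff]; tauto
  refine ⟨o, _, hc.mapLe (le_top : G ≤ ⊤), fun x y => ?_⟩
  rw [closedPath_adj hou huv hvr, SimpleGraph.Walk.edges_mapLe_eq_edges]
  simp

theorem closedPath_adj_left (hou : G.Adj o u) (huv : G.Adj u v) (hvr : G.Adj v r)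
    (hu : u ∉ P.support) (x : V) : (closedPath P u v).Adj u x ↔ x = o ∨ x = v := by
  have hur : u ≠ r := by rintro rfl; exact hu P.start_mem_support
  have h1 : s(u, x) ∉ P.edges := fun h => hu (P.fst_mem_support_of_mem_edges h)
  have := hou.ne
  have := huv.ne
  rw [closedPath_adj hou huv hvr]
  simp only [Sym2.eq_iff]
  tauto

theorem closedPath_adj_right (hou : G.Adj o u) (huv : G.Adj u v) (hvr : G.Adj v r)
    (hv : v ∉ P.support) (x : V) : (closedPath P u v).Adj v x ↔ x = u ∨ x = r := by
  have hvo : v ≠ o := by rintro rfl; exact hv P.end_mem_support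
  have h1 : s(v, x) ∉ P.edges := fun h => hv (P.fst_mem_support_of_mem_edges h)
  have := hvr.ne
  have := huv.ne
  rw [closedPath_adj hou huv hvr]
  simp only [Sym2.eq_iff]
  tauto

end Closed

namespace IsMinimalCounterexample

variable [Finite V] {G : SimpleGraph V}

/-- Split the edges according to whether they touch `A`. Degrees in the first part are even away
from `z`, hence everywhere by the handshake lemma. The parts share at most the vertex `z`, so `(2 *
k + 1) + (2 * l + 1) ≤ n + 1`, which is the bound for `k + l`. -/
theorem not_cut (hG : IsMinimalCounterexample G) {A : Set V} {z : V}
    (hA : ∀ a ∈ A, ∀ b, G.Adj a b → b ∈ A ∨ b = z)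
    (h1 : ∃ x y, G.Adj x y ∧ x ∈ A) (h2 : ∃ x y, G.Adj x y ∧ x ∉ A ∧ y ∉ A) : False := by
  have hle : touching G A ≤ G := fun x y h => h.1
  have he : ∀ w, w ≠ z → Even ((touching G A).neighborSet w).ncard := by
    intro w hw
    by_cases hwA : w ∈ A
    · rw [neighborSet_touching_of_mem hwA]; exact (hG.even w).1
    · have : (touching G A).neighborSet w = ∅ := by
        rw [neighborSet_touching_of_notMem hwA]
        ext x
        simp only [Set.mem_inter_iff, SimpleGraph.mem_neighborSet, Set.mem_empty_iff_false,
          iff_false, not_and]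
        intro h hx
        exact (hA x hx w h.symm).elim hwA hw
      rw [this]; simp
  have he' : ∀ w, Even ((touching G A).neighborSet w).ncard := fun w => by
    by_cases hw : w = z
    · exact hw ▸ even_ncard_neighborSet_of_forall_ne z he
    · exact he w hw
  obtain ⟨x, y, hxy, hx⟩ := h1
  obtain ⟨x', y', hxy', hx', hy'⟩ := h2
  have ht : (touching G A).Adj x y := ⟨hxy, Or.inl hx⟩
  have ht' : (G \ touching G A).Adj x' y' := ⟨hxy', fun h => h.2.elim hx' hy'⟩
  have hb : touching G A ≠ ⊥ := fun h => by rw [h] at ht; exact ht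
  have hb' : G \ touching G A ≠ ⊥ := fun h => by rw [h] at ht'; exact ht'
  obtain ⟨k, hk, hk'⟩ := hG.below _ (hG.even.of_le hle he') hb (by
    have := ncard_edgeSet_sdiff_lt (sdiff_le : G \ touching G A ≤ G) hb'
    rwa [sdiff_sdiff_eq_self hle] at this)
  obtain ⟨l, hl, hl'⟩ := hG.below _ (hG.even.sdiff hle he') hb' (ncard_edgeSet_sdiff_lt hle hb)
  refine hG.not_small ⟨k + l, ?_, ?_⟩
  · have := hk.union hl disjoint_sdiff_self_right
    rwa [sup_sdiff_cancel_right hle] at this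
  · have hun : (touching G A).support ∪ (G \ touching G A).support ⊆ G.support :=
      Set.union_subset (SimpleGraph.support_mono hle) (SimpleGraph.support_mono sdiff_le)
    have hin : (touching G A).support ∩ (G \ touching G A).support ⊆ {z} := by
      rintro w ⟨⟨a, ha⟩, ⟨b, hb⟩⟩
      by_contra hwz
      have hwA : w ∉ A := fun h => hb.2 ⟨hb.1, Or.inl h⟩
      rcases ha.2 with h | h
      · exact hwA h
      · exact (hA a h w ha.1.symm).elim hwA hwz
    have h3 := Set.ncard_le_ncard hun
    have h4 := Set.ncard_le_ncard hin
    rw [Set.ncard_singleton] at h4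
    have h5 := Set.ncard_union_add_ncard_inter (touching G A).support (G \ touching G A).support
    omega

theorem exists_walk_avoiding (hG : IsMinimalCounterexample G) {x y z : V} (hx : x ∈ G.support)
    (hy : y ∈ G.support) (hxz : x ≠ z) (hyz : y ≠ z) : ∃ p : G.Walk x y, z ∉ p.support := by
  by_contra hc
  obtain ⟨x', hx'⟩ := hx
  obtain ⟨y', hy'⟩ := hy
  have hA : ∀ a ∈ {a | ∃ p : G.Walk x a, z ∉ p.support}, ∀ b, G.Adj a b →
      b ∈ {a | ∃ p : G.Walk x a, z ∉ p.support} ∨ b = z := by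
    rintro a ⟨p, hp⟩ b hab
    by_cases hb : b = z
    · exact Or.inr hb
    · refine Or.inl ⟨p.concat hab, ?_⟩
      rw [SimpleGraph.Walk.support_concat]
      simp [hp, Ne.symm hb]
  refine hG.not_cut hA ⟨x, x', hx', .nil, by simpa using hxz.symm⟩ ⟨y, y', hy', hc, ?_⟩
  · intro h
    rcases hA y' h y hy'.symm with h | h
    · exact hc h
    · exact hyz h

/-- The cycle `o u v r P` leaves two vertices `u` and `v` that can be suppressed. -/
theorem not_consecutive (hG : IsMinimalCounterexample G) {u v o r s t y z : V} {P : G.Walk r o}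
    (hP : P.IsPath) (hu : u ∉ P.support) (hv : v ∉ P.support)
    (hNu : HasNeighbors G u v o s t) (hNv : HasNeighbors G v u r y z)
    (hst : G.Adj s t → s(s, t) ∈ P.edges) (hyz : G.Adj y z → s(y, z) ∈ P.edges)
    (hne : s(s, t) ≠ s(y, z)) : False := by
  have huv : G.Adj u v := by rw [hNu.adj_iff]; simp
  have hou : G.Adj o u := by rw [G.adj_comm, hNu.adj_iff]; simp
  have hvr : G.Adj v r := by rw [hNv.adj_iff]; simp
  have h1 := closedPath_adj_left hou huv hvr hu
  have h2 := closedPath_adj_right hou huv hvr hv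
  have hn1 := hNu.nodup
  have hn2 := hNv.nodup
  simp only [List.nodup_cons, List.mem_cons, not_or, List.not_mem_nil, not_false_eq_true,
    and_true] at hn1 hn2
  refine hG.not_small (hasSmallDecomposition_of_suppress_suppress (u := u) (v := v) (s := s)
    (t := t) (y := y) (z := z) hG.below hG.even (closedPath_le hou huv hvr)
    (isCycleGraph_closedPath hou huv hvr hP hu hv) huv.ne ?_ ?_ ?_ ?_ ?_ ?_ ?_ hne)
  · rw [SimpleGraph.sdiff_adj, h1]; tauto
  · intro x
    rw [SimpleGraph.sdiff_adj, h1, hNu.adj_iff]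
    grind
  · tauto
  · rintro ⟨h, h'⟩
    exact h' ((closedPath_adj hou huv hvr s t).2 (by have := hst h; tauto))
  · intro x
    rw [SimpleGraph.sdiff_adj, h2, hNv.adj_iff]
    grind
  · tauto
  · rintro ⟨h, h'⟩
    exact h' ((closedPath_adj hou huv hvr y z).2 (by have := hyz h; tauto))

/-- The cycle `o u v r P` isolates `v` and leaves a vertex `u` that can be suppressed. -/
theorem not_consecutive_of_two (hG : IsMinimalCounterexample G) {u v o r s t : V} {P : G.Walk r o}
    (hP : P.IsPath) (hu : u ∉ P.support) (hv : v ∉ P.support)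
    (hNu : HasNeighbors G u v o s t) (hNv : ∀ x, G.Adj v x ↔ x = u ∨ x = r)
    (hst : G.Adj s t → s(s, t) ∈ P.edges) : False := by
  have huv : G.Adj u v := by rw [hNu.adj_iff]; simp
  have hou : G.Adj o u := by rw [G.adj_comm, hNu.adj_iff]; simp
  have hvr : G.Adj v r := by rw [hNv]; simp
  have h1 := closedPath_adj_left hou huv hvr hu
  have h2 := closedPath_adj_right hou huv hvr hv
  have hn1 := hNu.nodup
  simp only [List.nodup_cons, List.mem_cons, not_or, List.not_mem_nil, not_false_eq_true,
    and_true] at hn1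
  refine hG.not_small (hasSmallDecomposition_of_isolate_suppress (u := u) (v := v) (s := s)
    (t := t) hG.below hG.even (closedPath_le hou huv hvr)
    (isCycleGraph_closedPath hou huv hvr hP hu hv) ⟨r, hvr⟩ ?_ ?_ ?_ ?_)
  · intro x
    rw [SimpleGraph.sdiff_adj, h2, hNv]; tauto
  · intro x
    rw [SimpleGraph.sdiff_adj, h1, hNu.adj_iff]
    grind
  · tauto
  · rintro ⟨h, h'⟩
    exact h' ((closedPath_adj hou huv hvr s t).2 (by have := hst h; tauto))

end IsMinimalCounterexample

/-! ### Labelling the four neighbours of a vertex -/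

section HasNeighbors

variable {G : SimpleGraph V} {u a b c d : V}

theorem HasNeighbors.swap₁ (h : HasNeighbors G u a b c d) : HasNeighbors G u b a c d :=
  ⟨fun x => by rw [h.adj_iff]; tauto, (List.Perm.swap a b [c, d]).nodup_iff.2 h.nodup⟩

theorem HasNeighbors.swap₂ (h : HasNeighbors G u a b c d) : HasNeighbors G u a c b d :=
  ⟨fun x => by rw [h.adj_iff]; tauto, ((List.Perm.swap b c [d]).cons a).nodup_iff.2 h.nodup⟩

theorem HasNeighbors.swap₃ (h : HasNeighbors G u a b c d) : HasNeighbors G u a b d c :=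
  ⟨fun x => by rw [h.adj_iff]; tauto,
    (((List.Perm.swap c d []).cons b).cons a).nodup_iff.2 h.nodup⟩

theorem HasNeighbors.adj (h : HasNeighbors G u a b c d) :
    G.Adj u a ∧ G.Adj u b ∧ G.Adj u c ∧ G.Adj u d := by
  simp [h.adj_iff]

theorem HasNeighbors.ne (h : HasNeighbors G u a b c d) :
    a ≠ b ∧ a ≠ c ∧ a ≠ d ∧ b ≠ c ∧ b ≠ d ∧ c ≠ d := by
  have := h.nodup
  simp only [List.nodup_cons, List.mem_cons, not_or, List.not_mem_nil, not_false_eq_true,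
    and_true] at this
  tauto

variable [Finite V]

theorem hasNeighbors_of_adj (h : (G.neighborSet u).ncard = 4) (ha : G.Adj u a) (hb : G.Adj u b)
    (hc : G.Adj u c) (hd : G.Adj u d) (hn : [a, b, c, d].Nodup) : HasNeighbors G u a b c d := by
  classical
  have hcard : ({a, b, c, d} : Set V).ncard = 4 := by
    have : ({a, b, c, d} : Set V) = ↑[a, b, c, d].toFinset := by ext; simp
    rw [this, Set.ncard_coe_finset, List.toFinset_card_of_nodup hn]
    rfl
  have : ({a, b, c, d} : Set V) = G.neighborSet u := by
    refine Set.eq_of_subset_of_ncard_le ?_ (by omega)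
    rintro x (rfl | rfl | rfl | rfl) <;> assumption
  exact ⟨fun x => by rw [← SimpleGraph.mem_neighborSet, ← this]; simp, hn⟩

theorem exists_hasNeighbors₃ (h : (G.neighborSet u).ncard = 4) (ha : G.Adj u a) (hb : G.Adj u b)
    (hc : G.Adj u c) (hab : a ≠ b) (hac : a ≠ c) (hbc : b ≠ c) :
    ∃ d, HasNeighbors G u a b c d := by
  classical
  have hcard : ({a, b, c} : Set V).ncard < (G.neighborSet u).ncard := by
    rw [h]
    have : ({a, b, c} : Set V) = ↑({a, b, c} : Finset V) := by simp
    rw [this, Set.ncard_coe_finset]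
    exact Finset.card_le_three.trans_lt (by norm_num)
  obtain ⟨d, hd, hd'⟩ := Set.exists_mem_notMem_of_ncard_lt_ncard hcard
  simp only [Set.mem_insert_iff, Set.mem_singleton_iff, not_or] at hd'
  refine ⟨d, hasNeighbors_of_adj h ha hb hc hd ?_⟩
  simp only [List.nodup_cons, List.mem_cons, not_or, List.not_mem_nil, not_false_eq_true,
    and_true, List.nodup_nil]
  tauto

theorem exists_hasNeighbors₂ (h : (G.neighborSet u).ncard = 4) (ha : G.Adj u a) (hb : G.Adj u b)
    (hab : a ≠ b) : ∃ c d, HasNeighbors G u a b c d := by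
  have hcard : ({a, b} : Set V).ncard < (G.neighborSet u).ncard := by
    rw [h, Set.ncard_pair hab]; norm_num
  obtain ⟨c, hc, hc'⟩ := Set.exists_mem_notMem_of_ncard_lt_ncard hcard
  simp only [Set.mem_insert_iff, Set.mem_singleton_iff, not_or] at hc'
  exact ⟨c, exists_hasNeighbors₃ h ha hb hc hab (Ne.symm hc'.1) (Ne.symm hc'.2)⟩

theorem exists_hasNeighbors₁ (h : (G.neighborSet u).ncard = 4) (ha : G.Adj u a) :
    ∃ b c d, HasNeighbors G u a b c d := by
  have hcard : ({a} : Set V).ncard < (G.neighborSet u).ncard := by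
    rw [h, Set.ncard_singleton]; norm_num
  obtain ⟨b, hb, hb'⟩ := Set.exists_mem_notMem_of_ncard_lt_ncard hcard
  exact ⟨b, exists_hasNeighbors₂ h ha hb (Ne.symm hb')⟩

end HasNeighbors

/-! ### A minimal counterexample has no vertex of degree 2 and contains a diamond -/

namespace IsMinimalCounterexample

variable [Finite V] {G : SimpleGraph V} (hG : IsMinimalCounterexample G)
include hG

theorem ncard_eq_two_or_four {u v : V} (h : G.Adj u v) :
    (G.neighborSet u).ncard = 2 ∨ (G.neighborSet u).ncard = 4 := by
  obtain ⟨⟨k, hk⟩, h4⟩ := hG.even u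
  have : (G.neighborSet u).ncard ≠ 0 := by
    rw [ne_eq, Set.ncard_eq_zero, ← ne_eq, ← Set.nonempty_iff_ne_empty]
    exact ⟨v, h⟩
  omega

theorem not_degree_two {v : V} (hv : (G.neighborSet v).ncard = 2) : False := by
  obtain ⟨a, b, hab, hN⟩ := Set.ncard_eq_two.1 hv
  have hN : ∀ x, G.Adj v x ↔ x = a ∨ x = b := fun x => by
    rw [← SimpleGraph.mem_neighborSet, hN]; simp
  have hva : G.Adj v a := (hN a).2 (Or.inl rfl)
  have hvb : G.Adj v b := (hN b).2 (Or.inr rfl)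
  have hadj : G.Adj a b := by
    by_contra h
    exact hG.not_small (hasSmallDecomposition_of_suppress hG.below hG.even hN hab h)
  have hab' : a ∉ (.nil : G.Walk b b).support := by simpa using hab
  have hvb' : v ∉ (.nil : G.Walk b b).support := by simpa using hvb.ne
  rcases hG.ncard_eq_two_or_four hadj with h2 | h4
  · have hNa : G.neighborSet a = {v, b} := by
      refine (Set.eq_of_subset_of_ncard_le ?_ ?_).symm
      · rintro x (rfl | rfl)
        exacts [hva.symm, hadj]
      · rw [h2, Set.ncard_pair hvb.ne]
    have hNa : ∀ x, G.Adj a x ↔ x = v ∨ x = b := fun x => by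
      rw [← SimpleGraph.mem_neighborSet, hNa]; simp
    -- With the trivial closing path this is the triangle `b a v`, whose removal isolates both `a`
    -- and `v`.
    have hC := isCycleGraph_closedPath hadj.symm hva.symm hvb .nil hab' hvb'
    have hle := closedPath_le (P := .nil) hadj.symm hva.symm hvb
    refine hG.not_small (hasSmallDecomposition_of_cycle hG.below hle hC
      (hG.even.sdiff_isCycleGraph hle hC) (fun _ h => h) le_rfl
      (ncard_add_two_le (u := a) (v := v) ?_ ⟨b, hadj⟩ ⟨b, hvb⟩ hva.ne'))
    rintro x ⟨y, hy⟩
    replace hy : (G \ closedPath _ a v).Adj x y := hy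
    refine ⟨⟨⟨y, hy.1⟩, ?_⟩, ?_⟩
    · rintro rfl
      rw [SimpleGraph.sdiff_adj, closedPath_adj_left hadj.symm hva.symm hvb hab', hNa] at hy
      tauto
    · rintro rfl
      rw [SimpleGraph.sdiff_adj, closedPath_adj_right hadj.symm hva.symm hvb hvb', hN] at hy
      tauto
  · obtain ⟨c, d, hNa⟩ := exists_hasNeighbors₂ h4 hva.symm hadj hvb.ne
    have hne := hNa.ne
    have had := hNa.adj
    -- Otherwise removing the triangle `b a v` isolates `v` and allows `a` to be suppressed.
    have hcd : G.Adj c d := by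
      by_contra h
      exact hG.not_consecutive_of_two .nil hab' hvb' hNa hN (fun h' => absurd h' h)
    -- Now the cycle leaves `a` through `c`, so that `b` and `d` remain. If they are adjacent, the
    -- cycle `c a v b d` uses up the edge `bd`; if not, any path from `b` to `c` avoiding `a` and
    -- `v` closes the cycle.
    by_cases hbd : G.Adj b d
    · refine hG.not_consecutive_of_two (P := .cons hbd (.cons hcd.symm .nil)) ?_ ?_ ?_
        hNa.swap₂ hN ?_
      · simp [hne, Ne.symm hne.2.2.2.2.2]
      · simp [had.2.1.ne, had.2.2.1.ne, had.2.2.2.ne]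
      · simp [hne]
      · simp
    · obtain ⟨W, hW⟩ := hG.exists_walk_avoiding (x := c) (y := b) (z := a) ⟨d, hcd⟩ ⟨a, hadj.symm⟩
        had.2.2.1.ne' had.2.1.ne'
      obtain ⟨s', s, q, hq, hs, hsS, -, hqS⟩ := exists_path_of_walk_to (S := {b, v}) W
        (by simp [hne.2.2.2.1.symm, hne.2.1.symm]) (by simp)
      have hs' := hqS s' q.end_mem_support
      simp only [Set.mem_insert_iff, Set.mem_singleton_iff, not_or] at hs' hsS hqS
      have hsb : s = b := by
        refine hsS.resolve_right ?_
        rintro rfl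
        rcases (hN s').1 hs.symm with rfl | rfl
        · exact hW hs'.2
        · exact hs'.1.1 rfl
      subst hsb
      refine hG.not_consecutive_of_two (P := .cons hs.symm q.reverse) ?_ ?_ ?_ hNa.swap₂ hN
        (fun h => absurd h hbd)
      · rw [SimpleGraph.Walk.cons_isPath_iff]
        exact ⟨hq.reverse, by simpa using fun h => (hqS s h).1.1 rfl⟩
      · simp only [SimpleGraph.Walk.support_cons, List.mem_cons, SimpleGraph.Walk.support_reverse,
          List.mem_reverse, not_or]
        exact ⟨hab, fun h => hW (hqS a h).2⟩
      · simp only [SimpleGraph.Walk.support_cons, List.mem_cons, SimpleGraph.Walk.support_reverse,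
          List.mem_reverse, not_or]
        exact ⟨hvb.ne, fun h => (hqS v h).1.2 rfl⟩

theorem ncard_eq_four {u v : V} (h : G.Adj u v) : (G.neighborSet u).ncard = 4 :=
  (hG.ncard_eq_two_or_four h).resolve_left hG.not_degree_two

/-- Without triangles the remaining neighbours of `u` and `v` on a cycle through `uv` are
nonadjacent, and the two pairs are disjoint, so the two-vertex tool applies. -/
theorem exists_triangle {u v : V} (huv : G.Adj u v) :
    ∃ a b c, G.Adj a b ∧ G.Adj a c ∧ G.Adj b c := by
  by_contra! hT
  obtain ⟨o, s, t, hNu⟩ := exists_hasNeighbors₁ (hG.ncard_eq_four huv) huv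
  have had := hNu.adj
  obtain ⟨W, hW⟩ := hG.exists_walk_avoiding (x := o) (y := v) (z := u) ⟨u, had.2.1.symm⟩
    ⟨u, huv.symm⟩ had.2.1.ne' huv.ne'
  obtain ⟨r, v', q, hq, hr, hvS, -, hqS⟩ := exists_path_of_walk_to (S := {v}) W
    (by simpa using hNu.ne.1.symm) (by simp)
  simp only [Set.mem_singleton_iff] at hvS hqS
  subst hvS
  have hur : u ≠ r := by
    rintro rfl
    exact hW (hqS u q.end_mem_support).2
  obtain ⟨y, z, hNv⟩ := exists_hasNeighbors₂ (hG.ncard_eq_four huv.symm) huv.symm hr.symm hur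
  have had' := hNv.adj
  refine hG.not_consecutive hq.reverse ?_ ?_ hNu hNv (fun h => absurd h (hT u s t had.2.2.1 had.2.2.2))
    (fun h => absurd h (hT v' y z had'.2.2.1 had'.2.2.2)) ?_
  · simpa using fun h => hW (hqS u h).2
  · simpa using fun h => (hqS v' h).1 rfl
  · rw [ne_eq, Sym2.eq_iff]
    rintro (⟨rfl, -⟩ | ⟨rfl, -⟩)
    · exact hT u v' s huv had.2.2.1 had'.2.2.1
    · exact hT u v' s huv had.2.2.1 had'.2.2.2

/-- The cycle `o u v r` leaves `w`, `t` at `u` and `w`, `y` at `v`. An edge inside either pair, or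
`t = y`, gives a second triangle on an edge of the triangle `u v w`. -/
theorem exists_diamond_of_path {u v w o r t : V} (hNu : HasNeighbors G u v o w t) (hvw : G.Adj v w)
    (hrv : G.Adj r v) {q : G.Walk o r} (hq : q.IsPath) (huq : u ∉ q.support)
    (hvq : v ∉ q.support) (hwr : w ≠ r) :
    ∃ a b c d, G.Adj a b ∧ G.Adj a c ∧ G.Adj b c ∧ G.Adj a d ∧ G.Adj b d ∧ c ≠ d := by
  by_contra! hD
  have had := hNu.adj
  have hur : u ≠ r := by
    rintro rfl
    exact huq q.end_mem_support
  obtain ⟨y, hNv⟩ := exists_hasNeighbors₃ (hG.ncard_eq_four hvw) had.1.symm hrv.symm hvw hur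
    had.2.2.1.ne hwr.symm
  have had' := hNv.adj
  refine hG.not_consecutive hq.reverse (by simpa using huq) (by simpa using hvq) hNu hNv ?_ ?_ ?_
  · intro h
    exact absurd (hD u w v t had.2.2.1 had.1 hvw.symm had.2.2.2 h) hNu.ne.2.2.1
  · intro h
    exact absurd (hD v w u y hvw had.1.symm had.2.2.1.symm had'.2.2.2 h) hNv.ne.2.2.1
  · rw [ne_eq, Sym2.eq_iff]
    rintro (⟨-, rfl⟩ | ⟨rfl, -⟩)
    · exact hNu.ne.2.2.2.2.2 (hD u v w t had.1 had.2.2.1 hvw had.2.2.2 had'.2.2.2)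
    · exact hNv.ne.2.2.2.2.2 rfl

theorem exists_diamond {u v w : V} (huv : G.Adj u v) (huw : G.Adj u w) (hvw : G.Adj v w) :
    ∃ a b c d, G.Adj a b ∧ G.Adj a c ∧ G.Adj b c ∧ G.Adj a d ∧ G.Adj b d ∧ c ≠ d := by
  obtain ⟨o, t, hNu⟩ := exists_hasNeighbors₂ (hG.ncard_eq_four huv) huv huw hvw.ne
  have had := hNu.adj
  have hne := hNu.ne
  obtain ⟨W, hW⟩ := hG.exists_walk_avoiding (x := o) (y := v) (z := u) ⟨u, had.2.2.1.symm⟩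
    ⟨u, huv.symm⟩ had.2.2.1.ne' huv.ne'
  obtain ⟨r, s, q, hq, hr, hsS, -, hqS⟩ := exists_path_of_walk_to (S := {v, w}) W
    (by simp [hne.2.1.symm, hne.2.2.2.1.symm]) (by simp)
  simp only [Set.mem_insert_iff, Set.mem_singleton_iff, not_or] at hsS hqS
  have hu : u ∉ q.support := fun h => hW (hqS u h).2
  have hv : v ∉ q.support := fun h => (hqS v h).1.1 rfl
  have hw : w ∉ q.support := fun h => (hqS w h).1.2 rfl
  rcases hsS with rfl | rfl
  · exact hG.exists_diamond_of_path hNu.swap₂ hvw hr hq hu hv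
      (by rintro rfl; exact hw q.end_mem_support)
  · exact hG.exists_diamond_of_path hNu.swap₁.swap₂ hvw.symm hr hq hu hw
      (by rintro rfl; exact hv q.end_mem_support)

/-! ### Adjacent vertices with the same three other neighbours -/

section ThreeCommon

variable {u v w x y : V} (hNu : HasNeighbors G u v w x y) (hNv : HasNeighbors G v u w x y)
include hNu hNv

theorem not_three_common_of_path (hwx : G.Adj w x) (hwy : G.Adj w y) : False := by
  have hne := hNu.ne
  have had := hNu.adj
  have hav := hNv.adj
  refine hG.not_consecutive (P := .cons hwy.symm (.cons hwx .nil)) ?_ ?_ ?_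
    hNu.swap₂ hNv.swap₃.swap₂ ?_ ?_ ?_
  · simp [hne, hwy.ne', hne.2.2.2.2.2.symm]
  · simp [had.2.1.ne, had.2.2.1.ne, had.2.2.2.ne]
  · simp [hav.2.1.ne, hav.2.2.1.ne, hav.2.2.2.ne]
  · simp
  · simp
  · rw [ne_eq, Sym2.eq_iff]
    have := hwy.ne
    have := hne.2.2.2.2.2
    grind

theorem not_three_common_of_edge (hwx : G.Adj w x) (hwy : ¬ G.Adj w y) (hxy : ¬ G.Adj x y) :
    False := by
  have hne := hNu.ne
  have had := hNu.adj
  have hav := hNv.adj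
  refine hG.not_consecutive (P := .cons hwx .nil) ?_ ?_ ?_
    hNu.swap₂ hNv (fun h => absurd h hwy) (fun h => absurd h hxy) ?_
  · simp [hwx.ne]
  · simp [had.2.1.ne, had.2.2.1.ne]
  · simp [hav.2.1.ne, hav.2.2.1.ne]
  · rw [ne_eq, Sym2.eq_iff]
    grind

theorem not_three_common_of_walk {s : V} (hwy : ¬ G.Adj w y)
    (hxy : ¬ G.Adj x y) {q : G.Walk w s} (hq : q.IsPath) (hs : G.Adj s x) (hu : u ∉ q.support)
    (hv : v ∉ q.support) (hx : x ∉ q.support) : False := by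
  have hne := hNu.ne
  have had := hNu.adj
  have hav := hNv.adj
  refine hG.not_consecutive (P := .cons hs.symm q.reverse) ?_ ?_ ?_
    hNu hNv.swap₂ (fun h => absurd h hxy) (fun h => absurd h hwy) ?_
  · rw [SimpleGraph.Walk.cons_isPath_iff]
    exact ⟨hq.reverse, by simpa using hx⟩
  · simp [had.2.2.1.ne, hu]
  · simp [hav.2.2.1.ne, hv]
  · rw [ne_eq, Sym2.eq_iff]
    grind

theorem not_three_common_of_independent (hwx : ¬ G.Adj w x) (hwy : ¬ G.Adj w y)
    (hxy : ¬ G.Adj x y) : False := by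
  have hne := hNu.ne
  have had := hNu.adj
  have hav := hNv.adj
  obtain ⟨c, d, hNw⟩ := exists_hasNeighbors₂ (hG.ncard_eq_four had.2.1.symm) had.2.1.symm
    hav.2.1.symm had.1.ne
  have haw := hNw.adj
  have hnw := hNw.ne
  obtain ⟨W, hW⟩ := hG.exists_walk_avoiding (x := c) (y := u) (z := w) ⟨w, haw.2.2.1.symm⟩
    ⟨w, had.2.1⟩ haw.2.2.1.ne' had.2.1.ne
  have hcx : c ≠ x := by rintro rfl; exact hwx haw.2.2.1
  have hcy : c ≠ y := by rintro rfl; exact hwy haw.2.2.1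
  obtain ⟨s', s, q, hq, hs, hsS, -, hqS⟩ := exists_path_of_walk_to (S := {u, v, x, y}) W
    (by simp [hcx, hcy, hnw.2.1.symm, hnw.2.2.2.1.symm]) (by simp)
  have hs' := hqS s' q.end_mem_support
  simp only [Set.mem_insert_iff, Set.mem_singleton_iff, not_or] at hs' hsS hqS
  have hsw : s' ≠ w := by rintro rfl; exact hW hs'.2
  -- The path cannot enter through `u` or `v`: all their other neighbours lie among `w`, `x`, `y`,
  -- and `w` is avoided.
  have hsx : s = x ∨ s = y := by
    rcases hsS with rfl | rfl | h
    · have := (hNu.adj_iff s').1 hs.symm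
      tauto
    · have := (hNv.adj_iff s').1 hs.symm
      tauto
    · exact h
  have hp : (SimpleGraph.Walk.cons haw.2.2.1 q).IsPath := by
    rw [SimpleGraph.Walk.cons_isPath_iff]
    exact ⟨hq, fun h => hW (hqS w h).2⟩
  have hm : ∀ {z}, z ≠ w → z = u ∨ z = v ∨ z = x ∨ z = y →
      z ∉ (SimpleGraph.Walk.cons haw.2.2.1 q).support := by
    intro z hzw hz h
    rw [SimpleGraph.Walk.support_cons, List.mem_cons] at h
    have := hqS z (h.resolve_left hzw)
    tauto
  rcases hsx with rfl | rfl
  · exact hG.not_three_common_of_walk hNu hNv hwy hxy hp hs (hm had.2.1.ne (by simp))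
      (hm hav.2.1.ne (by simp)) (hm hne.2.2.2.1.symm (by simp))
  · exact hG.not_three_common_of_walk hNu.swap₃ hNv.swap₃ hwx (fun h => hxy h.symm) hp hs
      (hm had.2.1.ne (by simp)) (hm hav.2.1.ne (by simp)) (hm hne.2.2.2.2.1.symm (by simp))

theorem not_three_common : False := by
  by_cases hwx : G.Adj w x <;> by_cases hwy : G.Adj w y <;> by_cases hxy : G.Adj x y
  · exact hG.not_three_common_of_path hNu hNv hwx hwy
  · exact hG.not_three_common_of_path hNu hNv hwx hwy
  · exact hG.not_three_common_of_path hNu.swap₂ hNv.swap₂ hwx.symm hxy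
  · exact hG.not_three_common_of_edge hNu hNv hwx hwy hxy
  · exact hG.not_three_common_of_path hNu.swap₃.swap₂ hNv.swap₃.swap₂ hwy.symm hxy.symm
  · exact hG.not_three_common_of_edge hNu.swap₃ hNv.swap₃ hwy hwx (fun h => hxy h.symm)
  · exact hG.not_three_common_of_edge hNu.swap₂.swap₃ hNv.swap₂.swap₃ hxy
      (fun h => hwx h.symm) (fun h => hwy h.symm)
  · exact hG.not_three_common_of_independent hNu hNv hwx hwy hxy

end ThreeCommon

end IsMinimalCounterexample

/-! ### Excluding diamonds: four-cliques, wheels and strips -/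

namespace IsMinimalCounterexample

variable [Finite V] {G : SimpleGraph V} (hG : IsMinimalCounterexample G)
include hG

/-- The fourth neighbours `a`, `b`, `d` of `u`, `v`, `x` are distinct, since no two adjacent
vertices share three neighbours. So the triangle `u v w` leaves the nonadjacent pairs `x`, `a` and
`x`, `b`. -/
theorem not_four_clique {u v w x : V} (huv : G.Adj u v) (huw : G.Adj u w) (hux : G.Adj u x)
    (hvw : G.Adj v w) (hvx : G.Adj v x) (hwx : G.Adj w x) : False := by
  obtain ⟨a, hNu⟩ := exists_hasNeighbors₃ (hG.ncard_eq_four huv) huv huw hux hvw.ne hvx.ne hwx.ne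
  obtain ⟨b, hNv⟩ := exists_hasNeighbors₃ (hG.ncard_eq_four huv.symm) huv.symm hvw hvx huw.ne
    hux.ne hwx.ne
  obtain ⟨d, hNx⟩ := exists_hasNeighbors₃ (hG.ncard_eq_four hux.symm) hux.symm hvx.symm hwx.symm
    huv.ne huw.ne hvw.ne
  have hau := hNu.adj.2.2.2.ne
  have hbv := hNv.adj.2.2.2.ne
  have hnu := hNu.ne
  have hnv := hNv.ne
  have hab : a ≠ b := by
    rintro rfl
    exact hG.not_three_common hNu hNv
  have had : a ≠ d := by
    rintro rfl
    exact hG.not_three_common hNu.swap₂.swap₁ hNx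
  have hbd : b ≠ d := by
    rintro rfl
    exact hG.not_three_common hNv.swap₂.swap₁ hNx.swap₁
  refine hG.not_consecutive (P := (.nil : G.Walk w w)) .nil (by simpa using huw.ne)
    (by simpa using hvw.ne) hNu hNv ?_ ?_ ?_
  · rw [hNx.adj_iff]
    grind
  · rw [hNx.adj_iff]
    grind
  · rw [ne_eq, Sym2.eq_iff]
    grind

/-- Removing the rim `v w a x` leaves the hub `u` and the outer neighbour at each rim vertex. These
are nonadjacent, so distinct outer neighbours of `v` and `w` would allow two suppressions. -/
theorem eq_of_wheel {u v w a x b c : V} (hNu : HasNeighbors G u v w a x) (hvw : G.Adj v w)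
    (hwa : G.Adj w a) (hax : G.Adj a x) (hxv : G.Adj x v) (hNv : HasNeighbors G v u w x b)
    (hNw : HasNeighbors G w u v a c) : b = c := by
  by_contra hbc
  have hu := hNu.adj
  have hne := hNu.ne
  have hva : ¬ G.Adj v a := fun h =>
    hG.not_four_clique hu.1 hu.2.1 hu.2.2.1 hvw h hwa
  have hwx : ¬ G.Adj w x := fun h =>
    hG.not_four_clique hu.1 hu.2.1 hu.2.2.2 hvw hxv.symm h
  have hvb := hNv.adj.2.2.2
  have hwc := hNw.adj.2.2.2
  have hnv := hNv.ne
  have hnw := hNw.ne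
  have hub : ¬ G.Adj u b := by
    rw [hNu.adj_iff]
    rintro (rfl | rfl | rfl | rfl)
    · exact hvb.ne rfl
    · exact hnv.2.2.2.2.1 rfl
    · exact hva hvb
    · exact hnv.2.2.2.2.2 rfl
  have huc : ¬ G.Adj u c := by
    rw [hNu.adj_iff]
    rintro (rfl | rfl | rfl | rfl)
    · exact hnw.2.2.2.2.1 rfl
    · exact hwc.ne rfl
    · exact hnw.2.2.2.2.2 rfl
    · exact hwx hwc
  refine hG.not_consecutive (P := .cons hax .nil) ?_ ?_ ?_
    hNv.swap₁.swap₂ hNw.swap₁.swap₂ (fun h => absurd h hub)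
      (fun h => absurd h huc) ?_
  · simp [hax.ne]
  · simp [hne]
  · simp [hne]
  · rw [ne_eq, Sym2.eq_iff]
    grind

theorem not_wheel {u v w a x : V} (hNu : HasNeighbors G u v w a x) (hvw : G.Adj v w)
    (hwa : G.Adj w a) (hax : G.Adj a x) (hxv : G.Adj x v) : False := by
  have hu := hNu.adj
  have hne := hNu.ne
  have h4 := fun {p q : V} (h : G.Adj p q) => hG.ncard_eq_four h
  obtain ⟨b, hNv⟩ := exists_hasNeighbors₃ (h4 hvw) hu.1.symm hvw hxv.symm hu.2.1.ne hu.2.2.2.ne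
    hne.2.2.2.2.1
  obtain ⟨c, hNw⟩ := exists_hasNeighbors₃ (h4 hwa) hu.2.1.symm hvw.symm hwa hu.1.ne hu.2.2.1.ne
    hne.2.1
  obtain ⟨d, hNa⟩ := exists_hasNeighbors₃ (h4 hax) hu.2.2.1.symm hwa.symm hax hu.2.1.ne
    hu.2.2.2.ne hne.2.2.2.2.1
  obtain ⟨e, hNx⟩ := exists_hasNeighbors₃ (h4 hxv) hu.2.2.2.symm hax.symm hxv hu.2.2.1.ne
    hu.1.ne hne.2.1.symm
  have hNu' : HasNeighbors G u w a x v := hNu.swap₁.swap₂.swap₃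
  have hNu'' : HasNeighbors G u a x v w := hNu'.swap₁.swap₂.swap₃
  obtain rfl := hG.eq_of_wheel hNu hvw hwa hax hxv hNv hNw
  obtain rfl := hG.eq_of_wheel hNu' hwa hax hxv hvw hNw.swap₂ hNa
  obtain rfl := hG.eq_of_wheel hNu'' hax hxv hvw hwa hNa.swap₂ hNx
  have hv := hNv.adj
  have hw := hNw.adj
  have ha := hNa.adj
  have hx := hNx.adj
  -- All rim vertices share one outer neighbour, which gives an octahedron. The cycle runs through
  -- all six of its vertices and uses the edge joining the remaining neighbours of `u`, and the one
  -- joining those of `v`.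
  refine hG.not_consecutive (P := .cons hwa (.cons ha.2.2.2 (.cons hx.2.2.2.symm .nil))) ?_ ?_ ?_
    hNu.swap₃.swap₂ hNv.swap₃ ?_ ?_ ?_
  · simp [hne, hx.2.2.2.ne', ha.2.2.2.ne, hw.2.2.2.ne]
  · simp [hu.2.1.ne, hu.2.2.1.ne, hu.2.2.2.ne, hNv.ne]
  · simp [hne, hv.2.2.2.ne]
  · simp
  · simp
  · rw [ne_eq, Sym2.eq_iff]
    have := hw.2.2.2.ne
    grind

/-- Separating the two ends of the strip `a, x, u, v, w, b` would need an edge cut of size three. -/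
theorem exists_walk_of_strip {u v w x a b : V} (hNu : HasNeighbors G u v w x a)
    (hNv : HasNeighbors G v u w x b) (hxa : G.Adj x a) (hav : a ≠ v) :
    ∃ t, (t = w ∨ t = b) ∧ ∃ p : G.Walk x t, u ∉ p.support ∧ v ∉ p.support := by
  by_contra! hc
  have hu := hNu.adj
  have hv := hNv.adj
  set A : Set V := {t | ∃ p : G.Walk x t, u ∉ p.support ∧ v ∉ p.support}
  have hxA : x ∈ A := ⟨.nil, by simpa using hu.2.2.1.ne, by simpa using hv.2.2.1.ne⟩
  have hstep : ∀ s ∈ A, ∀ t, G.Adj s t → t ≠ u → t ≠ v → t ∈ A := by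
    rintro s ⟨p, hp, hp'⟩ t hst htu htv
    exact ⟨p.concat hst, by simp [SimpleGraph.Walk.support_concat, hp, htu.symm],
      by simp [SimpleGraph.Walk.support_concat, hp', htv.symm]⟩
  have haA : a ∈ A := hstep x hxA a hxa hu.2.2.2.ne' hav
  have huA : u ∉ A := fun ⟨p, hp, _⟩ => hp p.end_mem_support
  have hvA : v ∉ A := fun ⟨p, _, hp⟩ => hp p.end_mem_support
  have hwA : w ∉ A := fun ⟨p, hp, hp'⟩ => hp' (hc w (Or.inl rfl) p hp)
  have hbA : b ∉ A := fun ⟨p, hp, hp'⟩ => hp' (hc b (Or.inr rfl) p hp)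
  have h1 : (touching G A).neighborSet u = {x, a} := by
    rw [neighborSet_touching_of_notMem huA]
    ext t
    simp only [Set.mem_inter_iff, SimpleGraph.mem_neighborSet, hNu.adj_iff, Set.mem_insert_iff,
      Set.mem_singleton_iff]
    constructor
    · rintro ⟨rfl | rfl | h, ht⟩
      exacts [absurd ht hvA, absurd ht hwA, h]
    · rintro (rfl | rfl)
      exacts [⟨by simp, hxA⟩, ⟨by simp, haA⟩]
  have h2 : (touching G A).neighborSet v = {x} := by
    rw [neighborSet_touching_of_notMem hvA]
    ext t
    simp only [Set.mem_inter_iff, SimpleGraph.mem_neighborSet, hNv.adj_iff, Set.mem_singleton_iff]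
    constructor
    · rintro ⟨rfl | rfl | rfl | rfl, ht⟩
      exacts [absurd ht huA, absurd ht hwA, rfl, absurd ht hbA]
    · rintro rfl
      exact ⟨by simp, hxA⟩
  -- In `touching G A` the vertex `u` has degree 2, vertices of `A` keep their even degree and the
  -- rest are isolated except `v`, which has degree 1.
  have := even_ncard_neighborSet_of_forall_ne (G := touching G A) v fun t htv => by
    by_cases htA : t ∈ A
    · rw [neighborSet_touching_of_mem htA]
      exact (hG.even t).1
    by_cases htu : t = u
    · rw [htu, h1, Set.ncard_pair hNu.ne.2.2.2.2.2]
      exact even_two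
    · have : (touching G A).neighborSet t = ∅ := by
        rw [neighborSet_touching_of_notMem htA]
        ext s
        simp only [Set.mem_inter_iff, SimpleGraph.mem_neighborSet, Set.mem_empty_iff_false,
          iff_false, not_and]
        exact fun h hs => htA (hstep s hs t h.symm htu htv)
      rw [this]
      simp
  rw [h2, Set.ncard_singleton] at this
  exact absurd this (by decide)

theorem not_strip {u v w x a b : V} (hNu : HasNeighbors G u v w x a)
    (hNv : HasNeighbors G v u w x b) (hwx : ¬ G.Adj w x) (hxa : G.Adj x a) (hwb : G.Adj w b)
    (hxb : ¬ G.Adj x b) (hwa : ¬ G.Adj w a) : False := by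
  have hu := hNu.adj
  have hv := hNv.adj
  have hnu := hNu.ne
  have hnv := hNv.ne
  obtain ⟨t, ht, W, huW, hvW⟩ := hG.exists_walk_of_strip hNu hNv hxa hnu.2.2.1.symm
  obtain ⟨s', s, q, hq, hs, hsS, -, hqS⟩ := exists_path_of_walk_to (S := {w, b}) W
    (by simp [hnu.2.2.2.1.symm, hnv.2.2.2.2.2]) (by simpa using ht)
  simp only [Set.mem_insert_iff, Set.mem_singleton_iff, not_or] at hsS hqS
  have hp : (SimpleGraph.Walk.cons hs.symm q.reverse).IsPath := by
    rw [SimpleGraph.Walk.cons_isPath_iff]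
    refine ⟨hq.reverse, fun h => ?_⟩
    rw [SimpleGraph.Walk.support_reverse, List.mem_reverse] at h
    exact (hqS s h).1.elim (fun h1 h2 => hsS.elim h1 h2)
  have hup : u ∉ (SimpleGraph.Walk.cons hs.symm q.reverse).support := by
    simp only [SimpleGraph.Walk.support_cons, List.mem_cons, SimpleGraph.Walk.support_reverse,
      List.mem_reverse, not_or]
    refine ⟨?_, fun h => huW (hqS u h).2⟩
    rcases hsS with rfl | rfl
    exacts [hu.2.1.ne, hnv.2.2.1]
  have hvp : v ∉ (SimpleGraph.Walk.cons hs.symm q.reverse).support := by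
    simp only [SimpleGraph.Walk.support_cons, List.mem_cons, SimpleGraph.Walk.support_reverse,
      List.mem_reverse, not_or]
    refine ⟨?_, fun h => hvW (hqS v h).2⟩
    rcases hsS with rfl | rfl
    exacts [hv.2.1.ne, hv.2.2.2.ne]
  generalize SimpleGraph.Walk.cons hs.symm q.reverse = p at hp hup hvp
  -- If the path ends at `w`, it is rerouted to start the cycle at `a`, leaving `x`, `w` at `u` and
  -- `x`, `b` at `v`. If it ends at `b`, the cycle through `x u v b` leaves `w`, `a` and `w`, `x`.
  rcases hsS with rfl | rfl
  · have key : ∀ p : G.Walk s a, p.IsPath → u ∉ p.support → v ∉ p.support → False := by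
      intro p hp hup hvp
      refine hG.not_consecutive hp hup hvp hNu.swap₃.swap₂.swap₃ hNv
        (fun h => absurd h.symm hwx) (fun h => absurd h hxb) ?_
      rw [ne_eq, Sym2.eq_iff]
      grind
    classical
    -- The path from `w` to `x` is cut at `a` if it meets `a`, and otherwise prolonged by the edge
    -- `xa`.
    by_cases hap : a ∈ p.support
    · exact key (p.takeUntil a hap) (hp.takeUntil hap)
        (fun h => hup (p.support_takeUntil_subset_support hap h))
        (fun h => hvp (p.support_takeUntil_subset_support hap h))
    · refine key (p.concat hxa) (hp.concat hap hxa) ?_ ?_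
      · simp [SimpleGraph.Walk.support_concat, hup, hu.2.2.2.ne]
      · simp [SimpleGraph.Walk.support_concat, hvp, hnu.2.2.1]
  · refine hG.not_consecutive hp hup hvp hNu.swap₂ hNv.swap₃.swap₂
      (fun h => absurd h hwa) (fun h => absurd h hwx) ?_
    rw [ne_eq, Sym2.eq_iff]
    grind

/-- Let `a`, `b` be the fourth neighbours of `u`, `v`. The triangles `u v w` and `u v x` force each
of `x`, `w` to be adjacent to `a` or `b`. A common choice makes a wheel with hub `u` or `v`, and
opposite choices make a strip. -/
theorem not_diamond {u v w x : V} (huv : G.Adj u v) (huw : G.Adj u w) (hvw : G.Adj v w)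
    (hux : G.Adj u x) (hvx : G.Adj v x) (hne : w ≠ x) : False := by
  obtain ⟨a, hNu⟩ := exists_hasNeighbors₃ (hG.ncard_eq_four huv) huv huw hux hvw.ne hvx.ne hne
  obtain ⟨b, hNv⟩ := exists_hasNeighbors₃ (hG.ncard_eq_four huv.symm) huv.symm hvw hvx huw.ne
    hux.ne hne
  have hnu := hNu.ne
  have hnv := hNv.ne
  have hab : a ≠ b := by
    rintro rfl
    exact hG.not_three_common hNu hNv
  have hwx : ¬ G.Adj w x := fun h => hG.not_four_clique huv huw hux hvw hvx h
  have hx : G.Adj x a ∨ G.Adj x b := by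
    by_contra! h
    refine hG.not_consecutive (P := (.nil : G.Walk w w)) .nil (by simpa using huw.ne)
      (by simpa using hvw.ne) hNu hNv (fun h' => absurd h' h.1) (fun h' => absurd h' h.2) ?_
    rw [ne_eq, Sym2.eq_iff]
    grind
  have hw : G.Adj w a ∨ G.Adj w b := by
    by_contra! h
    refine hG.not_consecutive (P := (.nil : G.Walk x x)) .nil (by simpa using hux.ne)
      (by simpa using hvx.ne) hNu.swap₂ hNv.swap₂ (fun h' => absurd h' h.1)
      (fun h' => absurd h' h.2) ?_
    rw [ne_eq, Sym2.eq_iff]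
    grind
  by_cases h1 : G.Adj x a ∧ G.Adj w a
  · exact hG.not_wheel hNu.swap₃ hvw h1.2 h1.1.symm hvx.symm
  by_cases h2 : G.Adj x b ∧ G.Adj w b
  · exact hG.not_wheel hNv.swap₃ huw h2.2 h2.1.symm hux.symm
  by_cases hxa : G.Adj x a
  · have hwb : G.Adj w b := by tauto
    exact hG.not_strip hNu hNv hwx hxa hwb (by tauto) (by tauto)
  · have hxb : G.Adj x b := by tauto
    have hwa : G.Adj w a := by tauto
    exact hG.not_strip hNu.swap₂ hNv.swap₂ (fun h => hwx h.symm) hwa hxb (by tauto) hxa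

theorem not_adj {u v : V} (huv : G.Adj u v) : False := by
  obtain ⟨a, b, c, hab, hac, hbc⟩ := hG.exists_triangle huv
  obtain ⟨p, q, r, s, h1, h2, h3, h4, h5, h6⟩ := hG.exists_diamond hab hac hbc
  exact hG.not_diamond h1 h2 h3 h4 h5 h6

end IsMinimalCounterexample

/-! ### The induction and the theorem -/

theorem IsEvenLeFour.hasSmallDecomposition [Finite V] {G : SimpleGraph V} (hG : IsEvenLeFour G)
    (hne : G ≠ ⊥) : HasSmallDecomposition G := by
  induction hn : G.edgeSet.ncard using Nat.strong_induction_on generalizing G with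
  | _ n ih =>
    by_contra hs
    obtain ⟨u, v, huv⟩ := exists_adj_of_ne_bot hne
    exact IsMinimalCounterexample.not_adj ⟨hG, fun H hH hb hlt => ih _ (hn ▸ hlt) hH hb rfl, hs⟩ huv

end CycleDecomp

/-- The finite bound also contains the existence of a decomposition, since `cycleNumber` is `⊤` when
there is none. -/
theorem mainTheorem4 {V : Type*} [Fintype V] (G : SimpleGraph V) [DecidableRel G.Adj] (n : ℕ)
    (hn : G.support.ncard = n) (hne : G ≠ ⊥) (hEuler : CycleDecomp.IsEulerianGraph G)
    (hdeg : G.maxDegree ≤ 4) :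
    CycleDecomp.cycleNumber G ≤ (((n - 1) / 2 : ℕ) : ℕ∞) := by
  have hd : ∀ v, (G.neighborSet v).ncard = G.degree v := fun v => by
    rw [Set.ncard_eq_toFinset_card', SimpleGraph.degree, SimpleGraph.neighborFinset]
  have hG : CycleDecomp.IsEvenLeFour G := fun v => by
    rw [hd]
    exact ⟨hEuler v, (G.degree_le_maxDegree v).trans hdeg⟩
  obtain ⟨k, hk, hk'⟩ := hG.hasSmallDecomposition hne
  refine hk.cycleNumber_le.trans ?_
  exact_mod_cast (by omega : k ≤ (n - 1) / 2)
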